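/- Let $m\ge 2$, $n\ge 1$, and let $P(\lambda)=\sum_{i=0}^m\lambda^iA_i$ with $A_i\in\mathbb C^{n\times n}$ and $A_m\ne 0$. **Elementary matrices.** The indices are $\pm0,\pm1,\dots,\pm m$, where $0$ and $-0$ are regarded as distinct. For $X\in\mathbb C^{n\times n}$ define the $mn\times mn$ matrices $$M_0(X)=\operatorname{diag}(I_{(m-1)n},X),\qquad M_{-m}(X)=\operatorname{diag}(X,I_{(m-1)n}),$$ and, for $1\le i\le m-1$, $$M_i(X)=\operatorname{diag}\!\left(I_{(m-i-1)n},\begin{bmatrix}X&I_n\\ I_n&0\end{bmatrix},I_{(i-1)n}\right),\qquad M_{-i}(X)=\operatorname{diag}\!\left(I_{(m-i-1)n},\begin{bmatrix}0&I_n\\ I_n&X\end{bmatrix},I_{(i-1)n}\right).$$ For nonsingular $X$ let $M_{-0}(X)=M_0(X)^{-1}$ and $M_m(X)=M_{-m}(X)^{-1}$. The Fiedler matrices of $P$ are $M_i^P=M_i(-A_i)$ for $0\le i\le m-1$, $M_{-i}^P=M_{-i}(A_i)$ for $1\le i\le m$, $M_{-0}^P=(M_0^P)^{-1}$ (if $A_0$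 is nonsingular) and $M_m^P=(M_{-m}^P)^{-1}$ (if $A_m$ is nonsingular). For an index tuple $\mathbf t=(t_1,\dots,t_r)$ put $M^P_{\mathbf t}=M^P_{t_1}\cdots M^P_{t_r}$. A *matrix assignment* for $\mathbf t$ is a tuple $X=(X_1,\dots,X_r)$ of matrices in $\mathbb C^{n\times n}$, and $M_{\mathbf t}(X)=M_{t_1}(X_1)\cdots M_{t_r}(X_r)$; for the empty tuple both products are $I_{mn}$. The assignment is *nonsingular* if $X_j$ is nonsingular whenever $t_j\in\{\pm0,\pm m\}$. A tuple $(i_1,\dots,i_t)$ of indices in $\{0,\dots,m\}$ satisfies the *successor infix property* (SIP) if for all $a<b$ with $i_a=i_b$ there is $c$ with $a<c<b$ and $i_c=i_a+1$; a tuple of indices in $\{-m,\dots,-0\}$ satisfies the SIP if the tuple obtained by adding $m$ to every entry does. **Extended generalized Fiedler pencils.** Let $(\sigma,\omega)$ be a permutation of $\{0,1,\dots,m\}$ (either part may be empty) and $\tau=-\omega$. Assume that $A_0$ is nonsingular if $-0\in\tau$ and that $A_m$ is nonsingular if $m\in\sigma$, so that $M^P_\tau$ and $M^P_\sigma$ are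 defined. Let $\sigma_1,\sigma_2$ be index tuples with entries in $\sigma\setminus\{m-1,m\}$ such that $(\sigma_1,\sigma,\sigma_2)$ satisfies the SIP, and let $\tau_1,\tau_2$ be index tuples with entries in $\tau\setminus\{-1,-0\}$ such that $(\tau_1,\tau,\tau_2)$ satisfies the SIP. Let $X_1,X_2,Y_1,Y_2$ be matrix assignments for $\sigma_1,\sigma_2,\tau_1,\tau_2$, respectively. **Theorem.** If the matrix assignments $X_1,X_2,Y_1,Y_2$ are nonsingular, then the extended generalized Fiedler pencil $$L(\lambda)=M_{\tau_1}(Y_1)\,M_{\sigma_1}(X_1)\,\bigl(\lambda M^P_\tau-M^P_\sigma\bigr)\,M_{\sigma_2}(X_2)\,M_{\tau_2}(Y_2)$$ is a strong linearization of $P(\lambda)$. That is, writing $L(\lambda)=L_0+\lambda L_1$, there are $mn\times mn$ matrix polynomials $U,V,\widetilde U,\widetilde V$ whose determinants are nonzero constants such that $$U(\lambda)L(\lambda)V(\lambda)=\operatorname{diag}(I_{(m-1)n},P(\lambda)),\qquad \widetilde U(\lambda)(L_1+\lambda L_0)\widetilde V(\lambda)=\operatorname{diag}(I_{(m-1)n},\lambda^mP(1/\lambda)).$$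 -/

import Mathlib

open scoped Polynomial

/-- Signed indices: `pos i` is the index `i` and `neg i` is the index `-i`.
The indices `0` (`pos 0`) and `-0` (`neg 0`) are distinct. -/
inductive SIndex where
  | pos (i : ℕ)
  | neg (i : ℕ)

/-- The absolute value of a signed index. -/
def SIndex.abs : SIndex → ℕ
  | .pos i => i
  | .neg i => i

/-- The integer value of a signed index (`0` and `-0` both have value `0`). -/
def SIndex.toInt : SIndex → ℤ
  | .pos i => (i : ℤ)
  | .neg i => -(i : ℤ)

/-- The Successor Infix Property: between any two occurrences of an index `s` there is an
occurrence of `s + 1`. -/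
def SIP (l : List ℤ) : Prop :=
  ∀ a b : Fin l.length, a < b → l.get a = l.get b →
    ∃ c : Fin l.length, a < c ∧ c < b ∧ l.get c = l.get a + 1

/-- The SIP for an index tuple with indices in `{0, …, m}`. -/
def SIPNonneg (t : List SIndex) : Prop := SIP (t.map SIndex.toInt)

/-- The SIP for an index tuple `t` with indices in `{-m, …, -0}`: the tuple `t + m` satisfies
the SIP. -/
def SIPNonpos (m : ℕ) (t : List SIndex) : Prop := SIP (t.map fun s => s.toInt + (m : ℤ))

/-- For `1 ≤ i ≤ m - 1`, the `m × m` block matrix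
`diag (I_{(m-i-1)n}, [B, I_n; I_n, D], I_{(i-1)n})`. Block rows and columns are numbered from `0`,
so the middle part occupies the block rows and columns `m-i-1` and `m-i`. -/
def midBlocks (m n i : ℕ) (B D : Matrix (Fin n) (Fin n) ℂ) :
    Matrix (Fin m) (Fin m) (Matrix (Fin n) (Fin n) ℂ) :=
  Matrix.of fun p q =>
    if (p : ℕ) + i + 1 = m ∧ (q : ℕ) + i + 1 = m then B
    else if (p : ℕ) + i = m ∧ (q : ℕ) + i = m then D
    else if (p : ℕ) + i + 1 = m ∧ (q : ℕ) + i = m then 1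
    else if (p : ℕ) + i = m ∧ (q : ℕ) + i + 1 = m then 1
    else if p = q then 1
    else 0

/-- `diag (I_{(m-1)n}, Z)`, as a block matrix. -/
def lastBlock {R : Type*} [CommRing R] (m n : ℕ) (Z : Matrix (Fin n) (Fin n) R) :
    Matrix (Fin m) (Fin m) (Matrix (Fin n) (Fin n) R) :=
  Matrix.diagonal fun p => if (p : ℕ) + 1 = m then Z else 1

/-- `diag (Z, I_{(m-1)n})`, as a block matrix. -/
def firstBlock {R : Type*} [CommRing R] (m n : ℕ) (Z : Matrix (Fin n) (Fin n) R) :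
    Matrix (Fin m) (Fin m) (Matrix (Fin n) (Fin n) R) :=
  Matrix.diagonal fun p => if (p : ℕ) = 0 then Z else 1

/-- The `mn × mn` matrix with the given `n × n` blocks. -/
def flat {R : Type*} {m n : ℕ} (Z : Matrix (Fin m) (Fin m) (Matrix (Fin n) (Fin n) R)) :
    Matrix (Fin m × Fin n) (Fin m × Fin n) R :=
  Matrix.comp (Fin m) (Fin m) (Fin n) (Fin n) R Z

/-- The elementary matrix `M_t(Z)` for a signed index `t ∈ {±0, …, ±m}`, where
`M_{-0}(Z) = M_0(Z)⁻¹` and `M_m(Z) = M_{-m}(Z)⁻¹`. -/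
noncomputable def elemMat (m n : ℕ) (t : SIndex) (Z : Matrix (Fin n) (Fin n) ℂ) :
    Matrix (Fin m × Fin n) (Fin m × Fin n) ℂ :=
  match t with
  | .pos i =>
      if i = 0 then flat (lastBlock m n Z)
      else if i = m then (flat (firstBlock m n Z))⁻¹
      else flat (midBlocks m n i Z 0)
  | .neg i =>
      if i = 0 then (flat (lastBlock m n Z))⁻¹
      else if i = m then flat (firstBlock m n Z)
      else flat (midBlocks m n i 0 Z)

/-- A matrix assignment for the index tuple `t`. -/
abbrev MatAssignment (n : ℕ) (t : List SIndex) : Type :=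
  Fin t.length → Matrix (Fin n) (Fin n) ℂ

/-- A matrix assignment is nonsingular if the matrices assigned to the positions of the indices
`±0` and `±m` are nonsingular. -/
def MatAssignment.Nonsingular (m : ℕ) {n : ℕ} {t : List SIndex} (Z : MatAssignment n t) : Prop :=
  ∀ k : Fin t.length, ((t.get k).abs = 0 ∨ (t.get k).abs = m) → IsUnit (Z k)

/-- `M_t(Z) = M_{t_1}(Z_1) ⋯ M_{t_r}(Z_r)`, the identity if `t` is empty. -/
noncomputable def elemProd (m : ℕ) {n : ℕ} (t : List SIndex) (Z : MatAssignment n t) :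
    Matrix (Fin m × Fin n) (Fin m × Fin n) ℂ :=
  (List.ofFn fun k : Fin t.length => elemMat m n (t.get k) (Z k)).prod

/-- The Fiedler matrix `M_t^P` of `P(λ) = ∑_{i ≤ m} λ^i A_i`, with
`M_i^P = M_i(-A_i)` for `0 ≤ i ≤ m - 1`, `M_{-i}^P = M_{-i}(A_i)` for `1 ≤ i ≤ m`,
`M_{-0}^P = (M_0^P)⁻¹` and `M_m^P = (M_{-m}^P)⁻¹`. -/
noncomputable def fiedlerMat (m : ℕ) {n : ℕ} (A : ℕ → Matrix (Fin n) (Fin n) ℂ) (t : SIndex) :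
    Matrix (Fin m × Fin n) (Fin m × Fin n) ℂ :=
  match t with
  | .pos i =>
      if i = m then (elemMat m n (.neg m) (A m))⁻¹ else elemMat m n (.pos i) (-(A i))
  | .neg i =>
      if i = 0 then (elemMat m n (.pos 0) (-(A 0)))⁻¹ else elemMat m n (.neg i) (A i)

/-- `M_t^P = M_{t_1}^P ⋯ M_{t_r}^P`, the identity if `t` is empty. -/
noncomputable def fiedlerProd (m : ℕ) {n : ℕ} (A : ℕ → Matrix (Fin n) (Fin n) ℂ)
    (t : List SIndex) : Matrix (Fin m × Fin n) (Fin m × Fin n) ℂ :=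
  (t.map (fiedlerMat m A)).prod

/-- A constant matrix, seen as a matrix polynomial. -/
noncomputable def constPoly {ι κ : Type*} (Z : Matrix ι κ ℂ) : Matrix ι κ ℂ[X] :=
  Z.map Polynomial.C

/-- The matrix polynomial `P(λ) = ∑_{i=0}^m λ^i A_i`. -/
noncomputable def matPoly (m : ℕ) {n : ℕ} (A : ℕ → Matrix (Fin n) (Fin n) ℂ) :
    Matrix (Fin n) (Fin n) ℂ[X] :=
  ∑ i ∈ Finset.range (m + 1), (Polynomial.X : ℂ[X]) ^ i • constPoly (A i)

/-- The reversal `λ^m P(1/λ)` of a matrix polynomial `P` of degree at most `m`. -/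
noncomputable def revPoly (m : ℕ) {n : ℕ} (P : Matrix (Fin n) (Fin n) ℂ[X]) :
    Matrix (Fin n) (Fin n) ℂ[X] :=
  P.map (Polynomial.reflect m)

/-- The pencil `U + λ V`. -/
noncomputable def pencil {ι : Type*} (U V : Matrix ι ι ℂ) : Matrix ι ι ℂ[X] :=
  constPoly U + (Polynomial.X : ℂ[X]) • constPoly V

/-- A unimodular matrix polynomial: its determinant is a nonzero constant. -/
def IsUnimodular {ι : Type*} [Fintype ι] [DecidableEq ι] (U : Matrix ι ι ℂ[X]) : Prop :=
  ∃ c : ℂ, c ≠ 0 ∧ U.det = Polynomial.C c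

/-- `U(λ) L(λ) V(λ) = diag (I_{(m-1)n}, P(λ))` for some unimodular `U` and `V`. -/
def IsLinearization (m : ℕ) {n : ℕ} (L : Matrix (Fin m × Fin n) (Fin m × Fin n) ℂ[X])
    (P : Matrix (Fin n) (Fin n) ℂ[X]) : Prop :=
  ∃ U V : Matrix (Fin m × Fin n) (Fin m × Fin n) ℂ[X],
    IsUnimodular U ∧ IsUnimodular V ∧ U * L * V = flat (lastBlock m n P)

/-- `L` is a pencil `L₀ + λ L₁` that is a linearization of the matrix polynomial `P` of degree
`m`, and `rev L = L₁ + λ L₀` is a linearization of `rev P`. -/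
def IsStrongLinearization (m : ℕ) {n : ℕ}
    (L : Matrix (Fin m × Fin n) (Fin m × Fin n) ℂ[X])
    (P : Matrix (Fin n) (Fin n) ℂ[X]) : Prop :=
  ∃ L₀ L₁ : Matrix (Fin m × Fin n) (Fin m × Fin n) ℂ,
    L = pencil L₀ L₁ ∧ IsLinearization m L P ∧ IsLinearization m (pencil L₁ L₀) (revPoly m P)

/-- The conditions on the index tuples of an extended generalized Fiedler pencil. Here
`σ` and `ω` are tuples of natural numbers, `(σ, ω)` is a permutation of `{0, …, m}`, and
`τ = -ω`. -/
structure IsEGFPTuple (m : ℕ) (σ ω : List ℕ) (σ₁ σ₂ τ₁ τ₂ : List SIndex) : Prop where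
  perm : (σ ++ ω).Perm (List.range (m + 1))
  mem_sigma : ∀ s, s ∈ σ₁ ∨ s ∈ σ₂ →
    s ∈ σ.map SIndex.pos ∧ s ≠ SIndex.pos (m - 1) ∧ s ≠ SIndex.pos m
  sip_sigma : SIPNonneg (σ₁ ++ σ.map SIndex.pos ++ σ₂)
  mem_tau : ∀ s, s ∈ τ₁ ∨ s ∈ τ₂ →
    s ∈ ω.map SIndex.neg ∧ s ≠ SIndex.neg 1 ∧ s ≠ SIndex.neg 0
  sip_tau : SIPNonpos m (τ₁ ++ ω.map SIndex.neg ++ τ₂)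

/-- The extended generalized Fiedler pencil
`M_{τ₁}(Y₁) M_{σ₁}(X₁) (λ M_τ^P - M_σ^P) M_{σ₂}(X₂) M_{τ₂}(Y₂)`, where `τ = -ω`. -/
noncomputable def egfp (m : ℕ) {n : ℕ} (A : ℕ → Matrix (Fin n) (Fin n) ℂ) (σ ω : List ℕ)
    {σ₁ σ₂ τ₁ τ₂ : List SIndex} (X₁ : MatAssignment n σ₁) (X₂ : MatAssignment n σ₂)
    (Y₁ : MatAssignment n τ₁) (Y₂ : MatAssignment n τ₂) :
    Matrix (Fin m × Fin n) (Fin m × Fin n) ℂ[X] :=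
  constPoly (elemProd m τ₁ Y₁) * constPoly (elemProd m σ₁ X₁) *
    ((Polynomial.X : ℂ[X]) • constPoly (fiedlerProd m A (ω.map SIndex.neg)) -
      constPoly (fiedlerProd m A (σ.map SIndex.pos))) *
    constPoly (elemProd m σ₂ X₂) * constPoly (elemProd m τ₂ Y₂)

/-! Write the pencil as U(λT − S)V with U, V the products of the outer elementary matrices and T, S
the products of Fiedler matrices over τ and σ. An elementary matrix with index other than ±0, ±m is
invertible whatever its block, and nonsingularity of the assignments covers the rest. So U and V are
constant invertible matrices, and everything reduces to λT − S and to its reversal T − λS.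

Moving invertible Fiedler factors across turns aT − bS into a·M_{-m}^P − b·(product of M_0^P, …,
M_{m-1}^P in some order), simultaneously for all scalars a, b (`exists_twoSidedEquiv_fiedler`). For
a = λ, b = 1 this Fiedler pencil is reduced by Horner's scheme (`twoSidedEquiv_hornerDiag`). The
factor of largest index k commutes with all others except k − 1, so it can be pushed to an end and
cancelled by its inverse. One elimination with pivot −I then replaces the current Horner value z by
A_k + λz. Starting from z = A_m, the process ends at diag(−I, P(λ)).

For a = 1, b = λ, cancelling all factors except M_0^P and reversing the order of the block rows and
columns gives, up to sign, a Fiedler pencil of −rev P, to which the first case applies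
(`twoSidedEquiv_elemLast_reverse`).

The reduction is done for m × m matrices over an arbitrary ring of blocks, with λ replaced by a
scalar t of the base ring K. -/

/-- Two elements of a ring are equivalent if they agree up to unit factors on both sides. -/
def TwoSidedEquiv {T : Type*} [Ring T] (x y : T) : Prop :=
  ∃ u v : Tˣ, (u : T) * x * v = y

namespace TwoSidedEquiv

variable {T : Type*} [Ring T] {x y z : T}

theorem of_eq (h : x = y) : TwoSidedEquiv x y := ⟨1, 1, by simp [h]⟩

theorem trans (h : TwoSidedEquiv x y) (h' : TwoSidedEquiv y z) : TwoSidedEquiv x z := by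
  obtain ⟨u, v, rfl⟩ := h
  obtain ⟨u', v', rfl⟩ := h'
  exact ⟨u' * u, v * v', by simp [mul_assoc]⟩

theorem neg (h : TwoSidedEquiv x y) : TwoSidedEquiv (-x) (-y) := by
  obtain ⟨u, v, rfl⟩ := h
  exact ⟨u, v, by simp⟩

theorem mul_units (u v : T) (hu : IsUnit u) (hv : IsUnit v) : TwoSidedEquiv x (u * x * v) := by
  obtain ⟨u, rfl⟩ := hu
  obtain ⟨v, rfl⟩ := hv
  exact ⟨u, v, rfl⟩

theorem of_mul_units (u v : T) (hu : IsUnit u) (hv : IsUnit v) :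
    TwoSidedEquiv (u * x * v) x := by
  obtain ⟨u, rfl⟩ := hu
  obtain ⟨v, rfl⟩ := hv
  exact ⟨u⁻¹, v⁻¹, by simp [mul_assoc]⟩

theorem map {T' : Type*} [Ring T'] (f : T →+* T') (h : TwoSidedEquiv x y) :
    TwoSidedEquiv (f x) (f y) := by
  obtain ⟨u, v, rfl⟩ := h
  exact ⟨Units.map f u, Units.map f v, by simp⟩

end TwoSidedEquiv

/-! ### From generalized Fiedler pencils to Fiedler pencils. -/

section PencilReduction

variable {K T : Type*} [CommRing K] [Ring T] [Algebra K T]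

theorem prod_map_mul_prod_map_reverse {f g : ℕ → T} (l : List ℕ)
    (h : ∀ i ∈ l, f i * g i = 1) : (l.map f).prod * (l.reverse.map g).prod = 1 := by
  induction l with
  | nil => simp
  | cons i l ih =>
    have hl := ih fun j hj => h j (List.mem_cons_of_mem _ hj)
    simp only [List.map_cons, List.prod_cons, List.reverse_cons, List.map_append, List.prod_append,
      List.map_nil, List.prod_nil, mul_one]
    calc _ = f i * ((l.map f).prod * (l.reverse.map g).prod) * g i := by simp only [mul_assoc]
      _ = 1 := by rw [hl, mul_one, h i List.mem_cons_self]

theorem prod_map_reverse_mul_prod_map {f g : ℕ → T} (l : List ℕ)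
    (h : ∀ i ∈ l, f i * g i = 1) : (l.reverse.map f).prod * (l.map g).prod = 1 := by
  simpa using prod_map_mul_prod_map_reverse l.reverse (fun i hi => h i (by simpa using hi))

theorem isUnit_prod_map {f g : ℕ → T} (l : List ℕ)
    (h : ∀ i ∈ l, f i * g i = 1 ∧ g i * f i = 1) : IsUnit (l.map f).prod :=
  ⟨⟨_, _, prod_map_mul_prod_map_reverse l fun i hi => (h i hi).1,
    prod_map_reverse_mul_prod_map l fun i hi => (h i hi).2⟩, rfl⟩

/-- Moving the invertible factors of a generalized Fiedler pencil to one side gives a Fiedler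
pencil. -/
theorem exists_twoSidedEquiv_fiedler (a b : K) {m : ℕ} {f g : ℕ → T} {σ ω : List ℕ}
    (hperm : (σ ++ ω).Perm (List.range (m + 1)))
    (hfg : ∀ i, i ≠ 0 → i < m → f i * g i = 1 ∧ g i * f i = 1)
    (h0 : 0 ∈ ω → f 0 * g 0 = 1 ∧ g 0 * f 0 = 1)
    (hmσ : m ∈ σ → f m * g m = 1 ∧ g m * f m = 1) :
    ∃ l : List ℕ, l.Perm (List.range m) ∧
      TwoSidedEquiv (a • (ω.map g).prod - b • (σ.map f).prod) (a • g m - b • (l.map f).prod) := by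
  have hnd : (σ ++ ω).Nodup := hperm.nodup_iff.2 List.nodup_range
  have hle : ∀ i ∈ σ ++ ω, i ≤ m := fun i hi => by
    have := hperm.mem_iff.1 hi
    simp at this; omega
  have hrange : (List.range (m + 1)).Perm (m :: List.range m) := by
    rw [List.range_succ]; exact List.perm_append_comm
  have hmem : m ∈ σ ++ ω := hperm.mem_iff.2 (by simp)
  rcases List.mem_append.1 hmem with hms | hmo
  · obtain ⟨s, t, rfl⟩ := List.append_of_mem hms
    -- This cyclic order is what remains of s, m, t once `f m` has been cancelled and the inverse of
    -- the ω-product has been carried over.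
    have hp : (t ++ ω.reverse ++ s).Perm (List.range m) := by
      have h1 : (m :: (t ++ ω.reverse ++ s)).Perm (s ++ m :: t ++ ω) := by
        rw [List.perm_iff_count]; intro x; simp [List.count_cons]; omega
      exact (List.perm_cons m).1 ((h1.trans hperm).trans hrange)
    have hmt : m ∉ t ++ ω.reverse ++ s := fun h => by simpa using hp.mem_iff.1 h
    have hgood : ∀ i ∈ t ++ ω.reverse ++ s, i ≠ 0 → f i * g i = 1 ∧ g i * f i = 1 := by
      intro i hi hi0
      exact hfg i hi0 (by simpa using hp.mem_iff.1 hi)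
    have hω : ∀ i ∈ ω, f i * g i = 1 ∧ g i * f i = 1 := fun i hi => by
      by_cases hi0 : i = 0
      · subst hi0; exact h0 hi
      · exact hgood i (by simp [hi]) hi0
    refine ⟨_, hp, ?_⟩
    have hW1 := prod_map_mul_prod_map_reverse (f := g) (g := f) ω fun i hi => (hω i hi).2
    have hW2 := prod_map_reverse_mul_prod_map (f := f) (g := g) ω fun i hi => (hω i hi).1
    have huf := isUnit_prod_map (f := f) (g := g) ω.reverse fun i hi => hω i (by simpa using hi)
    obtain ⟨hm1, hm2⟩ := hmσ hms
    have hugm : IsUnit (g m) := ⟨⟨g m, f m, hm2, hm1⟩, rfl⟩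
    simp only [List.map_append, List.map_cons, List.prod_append, List.prod_cons]
    set W := (ω.map g).prod
    set W' := (ω.reverse.map f).prod
    -- Only `f 0` can fail to be invertible among the factors around `f m`, so a side of m that
    -- avoids 0 can be inverted. Both choices lead to the same list.
    by_cases h0s : 0 ∈ s
    · have ht : ∀ i ∈ t, f i * g i = 1 ∧ g i * f i = 1 := fun i hi => by
        refine hgood i (by simp [hi]) ?_
        rintro rfl
        have := hnd.of_append_left
        rw [List.nodup_append] at this
        exact this.2.2 0 h0s 0 (by simp [hi]) rfl
      have hT1 := prod_map_mul_prod_map_reverse (f := f) (g := g) t fun i hi => (ht i hi).1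
      have hut := isUnit_prod_map (f := f) (g := g) t ht
      have hut' := isUnit_prod_map (f := g) (g := f) t.reverse
        fun i hi => (ht i (by simpa using hi)).symm
      set S := (s.map f).prod
      set Q := (t.map f).prod
      set Q' := (t.reverse.map g).prod
      -- On the right, `Q' * g m` cancels the tail `f m * Q`; on the left, `Q * W'` is chosen so
      -- that the leading term collapses to `g m`.
      have : (Q * W') * (a • W - b • (S * (f m * Q))) * (Q' * g m)
          = a • g m - b • (Q * W' * S) := by
        have e1 : (Q * W') * W * (Q' * g m) = g m := by
          calc _ = Q * (W' * W) * Q' * g m := by simp only [mul_assoc]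
            _ = g m := by rw [hW2, mul_one, hT1, one_mul]
        have e2 : (Q * W') * (S * (f m * Q)) * (Q' * g m) = Q * W' * S := by
          calc _ = (Q * W') * S * (f m * (Q * Q') * g m) := by simp only [mul_assoc]
            _ = _ := by rw [hT1, mul_one, hm1, mul_one]
        rw [mul_sub, sub_mul, mul_smul_comm, smul_mul_assoc, mul_smul_comm, smul_mul_assoc, e1, e2]
      rw [← this]
      exact TwoSidedEquiv.mul_units _ _ (hut.mul huf) (hut'.mul hugm)
    · have hs : ∀ i ∈ s, f i * g i = 1 ∧ g i * f i = 1 := fun i hi =>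
        hgood i (by simp [hi]) (by rintro rfl; exact h0s hi)
      have hS2 := prod_map_reverse_mul_prod_map (f := g) (g := f) s fun i hi => (hs i hi).2
      have hus := isUnit_prod_map (f := f) (g := g) s hs
      have hus' := isUnit_prod_map (f := g) (g := f) s.reverse
        fun i hi => (hs i (by simpa using hi)).symm
      set S := (s.map f).prod
      set Q := (t.map f).prod
      set S' := (s.reverse.map g).prod
      -- Mirror image: the head `S * f m` is cancelled on the left.
      have : (g m * S') * (a • W - b • (S * (f m * Q))) * (W' * S)
          = a • g m - b • (Q * W' * S) := by
        have e1 : (g m * S') * W * (W' * S) = g m := by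
          calc _ = g m * S' * (W * W') * S := by simp only [mul_assoc]
            _ = g m := by rw [hW1, mul_one, mul_assoc, hS2, mul_one]
        have e2 : (g m * S') * (S * (f m * Q)) * (W' * S) = Q * W' * S := by
          calc _ = g m * (S' * S) * f m * (Q * W' * S) := by simp only [mul_assoc]
            _ = _ := by rw [hS2, mul_one, hm2, one_mul]
        rw [mul_sub, sub_mul, mul_smul_comm, smul_mul_assoc, mul_smul_comm, smul_mul_assoc, e1, e2]
      rw [← this]
      exact TwoSidedEquiv.mul_units _ _ (hugm.mul hus') (huf.mul hus)
  · obtain ⟨s, t, rfl⟩ := List.append_of_mem hmo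
    have hp : (s.reverse ++ σ ++ t.reverse).Perm (List.range m) := by
      have h1 : (m :: (s.reverse ++ σ ++ t.reverse)).Perm (σ ++ (s ++ m :: t)) := by
        rw [List.perm_iff_count]; intro x; simp [List.count_cons]; omega
      exact (List.perm_cons m).1 ((h1.trans hperm).trans hrange)
    have hst : ∀ i, i ∈ s ∨ i ∈ t → f i * g i = 1 ∧ g i * f i = 1 := fun i hi => by
      by_cases hi0 : i = 0
      · subst hi0; exact h0 (by simp; tauto)
      · exact hfg i hi0 (by simpa using hp.mem_iff.1 (by simp; tauto : i ∈ s.reverse ++ σ ++ t.reverse))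
    refine ⟨_, hp, ?_⟩
    have hS := prod_map_reverse_mul_prod_map (f := f) (g := g) s fun i hi => (hst i (.inl hi)).1
    have hQ := prod_map_mul_prod_map_reverse (f := g) (g := f) t fun i hi => (hst i (.inr hi)).2
    have hus := isUnit_prod_map (f := f) (g := g) s.reverse
      fun i hi => hst i (.inl (by simpa using hi))
    have hut := isUnit_prod_map (f := f) (g := g) t.reverse
      fun i hi => hst i (.inr (by simpa using hi))
    simp only [List.map_append, List.map_cons, List.prod_append, List.prod_cons]
    set S := (s.map g).prod
    set Q := (t.map g).prod
    set S' := (s.reverse.map f).prod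
    set Q' := (t.reverse.map f).prod
    have : S' * (a • (S * (g m * Q)) - b • (σ.map f).prod) * Q'
        = a • g m - b • (S' * (σ.map f).prod * Q') := by
      have e1 : S' * (S * (g m * Q)) * Q' = g m := by
        calc _ = (S' * S) * g m * (Q * Q') := by simp only [mul_assoc]
          _ = g m := by rw [hS, hQ, mul_one, one_mul]
      rw [mul_sub, sub_mul, mul_smul_comm, smul_mul_assoc, mul_smul_comm, smul_mul_assoc, e1]
    rw [← this]
    exact TwoSidedEquiv.mul_units _ _ hus hut

end PencilReduction

/-! ### Fiedler matrices over a ring of blocks: supports, inverses, commutation. -/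

section BlockFiedler

open Matrix

variable {R : Type*} [Ring R] {m : ℕ}

/-- `X` agrees with the identity outside the rows and columns in `S`. -/
def IdOutside (S : Set (Fin m)) (X : Matrix (Fin m) (Fin m) R) : Prop :=
  ∀ p q, p ∉ S ∨ q ∉ S → X p q = (1 : Matrix (Fin m) (Fin m) R) p q

theorem IdOutside.mono {S S' : Set (Fin m)} {X : Matrix (Fin m) (Fin m) R} (h : IdOutside S X)
    (hS : S ⊆ S') : IdOutside S' X := fun p q hpq =>
  h p q (hpq.imp (fun h h' => h (hS h')) fun h h' => h (hS h'))

theorem IdOutside.one (S : Set (Fin m)) : IdOutside S (1 : Matrix (Fin m) (Fin m) R) :=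
  fun _ _ _ => rfl

theorem IdOutside.mul {S : Set (Fin m)} {X Y : Matrix (Fin m) (Fin m) R} (hX : IdOutside S X)
    (hY : IdOutside S Y) : IdOutside S (X * Y) := by
  rintro p q (h | h)
  · calc (X * Y) p q = ((1 : Matrix (Fin m) (Fin m) R) * Y) p q := by
          simp only [Matrix.mul_apply, hX p _ (.inl h)]
      _ = _ := by rw [one_mul, hY p q (.inl h)]
  · calc (X * Y) p q = (X * (1 : Matrix (Fin m) (Fin m) R)) p q := by
          simp only [Matrix.mul_apply, hY _ q (.inr h)]
      _ = _ := by rw [mul_one, hX p q (.inr h)]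

theorem IdOutside.list_prod {S : Set (Fin m)} {F : ℕ → Matrix (Fin m) (Fin m) R} (l : List ℕ)
    (h : ∀ i ∈ l, IdOutside S (F i)) : IdOutside S (l.map F).prod := by
  induction l with
  | nil => exact .one S
  | cons i l ih =>
    rw [List.map_cons, List.prod_cons]
    exact (h i List.mem_cons_self).mul (ih fun j hj => h j (List.mem_cons_of_mem _ hj))

/-- The nonzero columns of `X - 1` lie in `S` and the nonzero rows of `Y - 1` in `S'`, so no
summation index contributes. -/
theorem IdOutside.sub_one_mul {S S' : Set (Fin m)} {X Y : Matrix (Fin m) (Fin m) R}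
    (hX : IdOutside S X) (hY : IdOutside S' Y) (hd : Disjoint S S') : (X - 1) * (Y - 1) = 0 := by
  ext p q
  rw [Matrix.mul_apply]
  refine Finset.sum_eq_zero fun j _ => ?_
  by_cases hj : j ∈ S
  · simp [hY j q (.inl (Set.disjoint_left.1 hd hj))]
  · simp [hX p j (.inr hj)]

/-- Since (X − 1)(Y − 1) = 0 = (Y − 1)(X − 1), both products equal X + Y − 1. -/
theorem IdOutside.commute {S S' : Set (Fin m)} {X Y : Matrix (Fin m) (Fin m) R}
    (hX : IdOutside S X) (hY : IdOutside S' Y) (hd : Disjoint S S') : Commute X Y := by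
  have h1 := hX.sub_one_mul hY hd
  have h2 := hY.sub_one_mul hX hd.symm
  have e1 : X * Y = X + Y - 1 := by
    rw [← sub_eq_zero, ← h1]; noncomm_ring
  have e2 : Y * X = X + Y - 1 := by
    rw [← sub_eq_zero, ← h2]; noncomm_ring
  exact e1.trans e2.symm

theorem IdOutside.mul_single {S : Set (Fin m)} {X : Matrix (Fin m) (Fin m) R} (hX : IdOutside S X)
    {p : Fin m} (hp : p ∉ S) (q : Fin m) (x : R) : X * single p q x = single p q x := by
  have h : (X - 1) * single p q x = 0 := by
    ext a b
    rw [Matrix.mul_apply]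
    refine Finset.sum_eq_zero fun j _ => ?_
    by_cases hj : j = p
    · subst hj; simp [hX a j (.inr hp)]
    · simp [single, Ne.symm hj]
  rwa [sub_mul, one_mul, sub_eq_zero] at h

theorem IdOutside.single_mul {S : Set (Fin m)} {X : Matrix (Fin m) (Fin m) R} (hX : IdOutside S X)
    {p : Fin m} (hp : p ∉ S) (q : Fin m) (x : R) : single q p x * X = single q p x := by
  have h : single q p x * (X - 1) = 0 := by
    ext a b
    rw [Matrix.mul_apply]
    refine Finset.sum_eq_zero fun j _ => ?_
    by_cases hj : j = p
    · subst hj; simp [hX j b (.inl hp)]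
    · simp [single, Ne.symm hj]
  rwa [mul_sub, mul_one, sub_eq_zero] at h

/-- The block matrix `diag (I, [B, I; I, D], I)`, where the middle part occupies the block rows and
columns `m - i - 1` and `m - i`. -/
def elemMid (m i : ℕ) (B D : R) : Matrix (Fin m) (Fin m) R :=
  Matrix.of fun p q =>
    if (p : ℕ) + i + 1 = m ∧ (q : ℕ) + i + 1 = m then B
    else if (p : ℕ) + i = m ∧ (q : ℕ) + i = m then D
    else if (p : ℕ) + i + 1 = m ∧ (q : ℕ) + i = m then 1
    else if (p : ℕ) + i = m ∧ (q : ℕ) + i + 1 = m then 1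
    else if p = q then 1
    else 0

/-- `diag (I, Z)`. -/
def elemLast (m : ℕ) (Z : R) : Matrix (Fin m) (Fin m) R :=
  Matrix.diagonal fun p => if (p : ℕ) + 1 = m then Z else 1

/-- `diag (Z, I)`. -/
def elemFirst (m : ℕ) (Z : R) : Matrix (Fin m) (Fin m) R :=
  Matrix.diagonal fun p => if (p : ℕ) = 0 then Z else 1

/-- The block Fiedler matrix with index `i < m`. -/
def blockFiedler (m : ℕ) (A : ℕ → R) (i : ℕ) : Matrix (Fin m) (Fin m) R :=
  if i = 0 then elemLast m (-A 0) else elemMid m i (-A i) 0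

/-- In this form products of elementary matrices follow from the multiplication rules for matrix
units. -/
theorem elemMid_eq {i : ℕ} {p q : Fin m} (hp : (p : ℕ) + i + 1 = m) (hq : (q : ℕ) + i = m)
    (B D : R) : elemMid m i B D = 1 - single p p 1 - single q q 1 + single p p B + single q q D
      + single p q 1 + single q p 1 := by
  have hpq : p ≠ q := by rintro rfl; omega
  have h1 : ∀ r : Fin m, (r : ℕ) + i + 1 = m ↔ r = p := fun r => by rw [Fin.ext_iff]; omega
  have h2 : ∀ r : Fin m, (r : ℕ) + i = m ↔ r = q := fun r => by rw [Fin.ext_iff]; omega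
  ext r c
  simp only [elemMid, h1, h2, of_apply, Matrix.add_apply, Matrix.sub_apply, single,
    Matrix.one_apply]
  by_cases hr : r = p <;> by_cases hr' : r = q <;> by_cases hc : c = p <;> by_cases hc' : c = q <;>
    simp_all [eq_comm]

theorem elemMid_mul_elemMid {i : ℕ} (hi0 : i ≠ 0) (hi : i < m) (A : R) :
    elemMid m i (-A) 0 * elemMid m i 0 A = 1 := by
  let p : Fin m := ⟨m - i - 1, by omega⟩
  let q : Fin m := ⟨m - i, by omega⟩
  have hpq : p ≠ q := by simp [p, q, Fin.ext_iff]; omega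
  rw [elemMid_eq (p := p) (q := q) (by simp [p]; omega) (by simp [q]; omega),
    elemMid_eq (p := p) (q := q) (by simp [p]; omega) (by simp [q]; omega)]
  simp only [mul_add, mul_sub, add_mul, sub_mul, single_mul_single_same, one_mul, mul_one,
    single_mul_single_of_ne _ _ _ _ hpq, single_mul_single_of_ne _ _ _ _ hpq.symm, single_zero,
    neg_mul, mul_zero, zero_mul, ← single_neg]
  abel

theorem elemMid_mul_elemMid' {i : ℕ} (hi0 : i ≠ 0) (hi : i < m) (A : R) :
    elemMid m i 0 A * elemMid m i (-A) 0 = 1 := by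
  let p : Fin m := ⟨m - i - 1, by omega⟩
  let q : Fin m := ⟨m - i, by omega⟩
  have hpq : p ≠ q := by simp [p, q, Fin.ext_iff]; omega
  rw [elemMid_eq (p := p) (q := q) (by simp [p]; omega) (by simp [q]; omega),
    elemMid_eq (p := p) (q := q) (by simp [p]; omega) (by simp [q]; omega)]
  simp only [mul_add, mul_sub, add_mul, sub_mul, single_mul_single_same, one_mul, mul_one,
    single_mul_single_of_ne _ _ _ _ hpq, single_mul_single_of_ne _ _ _ _ hpq.symm, single_zero,
    mul_neg, mul_zero, zero_mul, ← single_neg]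
  abel

/-- The support consists of the block rows m − i − 1 and m − i. For i = 0 the second is out of
range, which leaves only the last block row. -/
theorem idOutside_blockFiedler (A : ℕ → R) (i : ℕ) :
    IdOutside {p : Fin m | m ≤ p + i + 1 ∧ (p : ℕ) + i ≤ m} (blockFiedler m A i) := by
  intro p q h
  simp only [Set.mem_ofPred_eq] at h
  unfold blockFiedler
  split_ifs with hi
  · rw [elemLast, Matrix.diagonal_apply, Matrix.one_apply]
    split_ifs with h1 h2
    · subst h1; omega
    · rfl
    · rfl
  · rw [elemMid, of_apply, Matrix.one_apply]
    have h1 : ¬ ((p : ℕ) + i + 1 = m ∧ (q : ℕ) + i + 1 = m) := by omega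
    have h2 : ¬ ((p : ℕ) + i = m ∧ (q : ℕ) + i = m) := by omega
    have h3 : ¬ ((p : ℕ) + i + 1 = m ∧ (q : ℕ) + i = m) := by omega
    have h4 : ¬ ((p : ℕ) + i = m ∧ (q : ℕ) + i + 1 = m) := by omega
    rw [if_neg h1, if_neg h2, if_neg h3, if_neg h4]

theorem commute_blockFiedler (A : ℕ → R) {i j : ℕ} (h : i + 2 ≤ j) :
    Commute (blockFiedler m A i) (blockFiedler m A j) := by
  refine (idOutside_blockFiedler A i).commute (idOutside_blockFiedler A j) ?_
  rw [Set.disjoint_left]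
  intro p hp hp'
  simp only [Set.mem_ofPred_eq] at hp hp'
  omega

/-- A Fiedler factor with the largest index can be moved to one of the two ends. -/
theorem prod_blockFiedler_eq (A : ℕ → R) {k : ℕ} {l : List ℕ}
    (hl : l.Perm (List.range (k + 1))) :
    ∃ l' : List ℕ, l'.Perm (List.range k) ∧
      ((l.map (blockFiedler m A)).prod = (l'.map (blockFiedler m A)).prod * blockFiedler m A k ∨
        (l.map (blockFiedler m A)).prod =
          blockFiedler m A k * (l'.map (blockFiedler m A)).prod) := by
  obtain ⟨s, t, rfl⟩ := List.append_of_mem (hl.mem_iff.2 (by simp : k ∈ List.range (k + 1)))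
  have hp : (s ++ t).Perm (List.range k) := by
    refine (List.perm_cons k).1 (List.perm_middle.symm.trans (hl.trans ?_))
    rw [List.range_succ]; exact List.perm_append_comm
  have hlt : ∀ i ∈ s ++ t, i < k := fun i hi => by simpa using hp.mem_iff.1 hi
  have hnd : (s ++ t).Nodup := hp.nodup_iff.2 List.nodup_range
  have hcomm : ∀ r : List ℕ, (∀ i ∈ r, i + 2 ≤ k) →
      Commute (r.map (blockFiedler m A)).prod (blockFiedler m A k) := fun r hr => by
    refine Commute.list_prod_left _ _ fun x hx => ?_
    obtain ⟨i, hi, rfl⟩ := List.mem_map.1 hx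
    exact commute_blockFiedler A (hr i hi)
  refine ⟨s ++ t, hp, ?_⟩
  simp only [List.map_append, List.map_cons, List.prod_append, List.prod_cons]
  -- Among the indices below k only k − 1 has support meeting that of k. The factor k therefore
  -- slides past whichever of `s`, `t` avoids k − 1. For k = 0 both lists are empty.
  by_cases hs : k - 1 ∈ s
  · left
    have := hcomm t fun i hi => by
      have h1 := hlt i (by simp [hi])
      have h2 : i ≠ k - 1 := by
        rintro rfl
        exact (List.nodup_append.1 hnd).2.2 _ hs _ hi rfl
      omega
    rw [← this.eq, mul_assoc]
  · right
    have := hcomm s fun i hi => by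
      have h1 := hlt i (by simp [hi])
      have h2 : i ≠ k - 1 := by
        rintro rfl
        exact hs hi
      omega
    rw [← mul_assoc, this.eq, mul_assoc]

theorem isUnit_one_add_single {p q : Fin m} (h : p ≠ q) (x : R) :
    IsUnit (1 + single p q x : Matrix (Fin m) (Fin m) R) := by
  have h0 : single p q x * single p q x = 0 := single_mul_single_of_ne _ _ _ _ h.symm _ 
  refine ⟨⟨1 + single p q x, 1 - single p q x, ?_, ?_⟩, rfl⟩
  · rw [add_mul, mul_sub, mul_sub, h0]; simp
  · rw [sub_mul, mul_add, mul_add, h0]; simp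

/-- The entry at (p, p) is −1, because `d p = 0` and `N` is the identity at p. Adding x times row p
to row q and y-multiples of column p to column q clears the two off-diagonal entries, and the Schur
complement contributes x * y at (q, q), which cancels −x * y. -/
theorem twoSidedEquiv_sub_of_pivot {p q : Fin m} (hpq : p ≠ q) {S : Set (Fin m)}
    {N : Matrix (Fin m) (Fin m) R} (hN : IdOutside S N) (hp : p ∉ S) {d : Fin m → R}
    (hd : d p = 0) (x y : R) :
    TwoSidedEquiv (diagonal d - single q q (x * y) + single q p x + single p q y - N)
      (diagonal d - N) := by
  have hx := isUnit_one_add_single hpq.symm x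
  have hy := isUnit_one_add_single hpq y
  have e0 : single q p x * single q q (x * y) = 0 := single_mul_single_of_ne _ _ _ _ hpq _
  have e1 : single q p x * single q p x = 0 := single_mul_single_of_ne _ _ _ _ hpq _
  have e2 : single p q y * single p q y = 0 := single_mul_single_of_ne _ _ _ _ hpq.symm _
  have e3 : single q p x * single p q y = single q q (x * y) := single_mul_single_same _ _ _ _ _
  have e4 : single q p x * diagonal d = 0 := by
    ext a b; rw [mul_diagonal]; by_cases hb : b = p
    · subst hb; simp [hd]
    · simp [single, Ne.symm hb]
  have e5 : diagonal d * single p q y = 0 := by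
    ext a b; rw [diagonal_mul]; by_cases ha : a = p
    · subst ha; simp [hd]
    · simp [single, Ne.symm ha]
  have e6 := hN.single_mul hp q x
  have e7 := hN.mul_single hp q y
  have : (1 + single q p x) *
      (diagonal d - single q q (x * y) + single q p x + single p q y - N) * (1 + single p q y)
      = diagonal d - N := by
    have : (1 + single q p x) *
        (diagonal d - single q q (x * y) + single q p x + single p q y - N)
        = diagonal d + single p q y - N := by
      rw [add_mul, one_mul, mul_sub, mul_add, mul_add, mul_sub, e0, e1, e3, e4, e6]
      abel
    rw [this, mul_add, mul_one, sub_mul, add_mul, e2, e5, e7]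
    abel
  rw [← this]
  exact TwoSidedEquiv.mul_units _ _ hx hy

/-! ### Horner elimination for Fiedler pencils. -/

variable {K : Type*} [CommRing K] [Algebra K R]

/-- The diagonal entries of the leading part of a partially reduced Fiedler pencil. -/
def hornerDiag (m k : ℕ) (t : K) (z : R) (p : Fin m) : R :=
  if (p : ℕ) + k < m then 0 else if (p : ℕ) + k = m then t • z else t • 1

theorem diagonal_mul_single (d : Fin m → R) (p q : Fin m) (x : R) :
    diagonal d * single p q x = single p q (d p * x) := by
  ext a b
  rw [diagonal_mul]
  by_cases ha : p = a
  · subst ha; by_cases hb : q = b <;> simp [single, hb]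
  · simp [single, ha]

theorem single_mul_diagonal (d : Fin m → R) (p q : Fin m) (x : R) :
    single p q x * diagonal d = single p q (x * d q) := by
  ext a b
  rw [mul_diagonal]
  by_cases hb : q = b
  · subst hb; by_cases ha : p = a <;> simp [single, ha]
  · simp [single, hb]

theorem hornerDiag_of_add_eq {k : ℕ} (t : K) (z : R) {p : Fin m} (hp : (p : ℕ) + k = m) :
    hornerDiag m k t z p = t • z := by
  rw [hornerDiag, if_neg (by omega), if_pos hp]

theorem hornerDiag_of_lt_add {k : ℕ} (t : K) (z : R) {p : Fin m} (hp : m < (p : ℕ) + k) :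
    hornerDiag m k t z p = t • 1 := by
  rw [hornerDiag, if_neg (by omega), if_neg (by omega)]

theorem diagonal_hornerDiag {k : ℕ} {p q : Fin m} (hp : (p : ℕ) + k + 1 = m)
    (hq : (q : ℕ) + k = m) (t : K) (z w : R) :
    diagonal (hornerDiag m k t w) = diagonal (hornerDiag m (k + 1) t z) - single p p (t • z)
      - single q q (t • 1) + single q q (t • w) := by
  ext a b
  by_cases hab : a = b
  · subst hab
    simp only [Matrix.add_apply, Matrix.sub_apply, diagonal_apply_eq, single, of_apply, and_self]
    rcases lt_trichotomy ((a : ℕ) + k + 1) m with h | h | h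
    · have a1 : ¬ p = a := by rintro rfl; omega
      have a2 : ¬ q = a := by rintro rfl; omega
      rw [hornerDiag, if_pos (by omega), hornerDiag, if_pos (by omega), if_neg a1, if_neg a2,
        if_neg a2]
      simp
    · obtain rfl : p = a := Fin.ext (by omega)
      have a2 : ¬ q = p := by rintro rfl; omega
      rw [hornerDiag, if_pos (by omega), hornerDiag_of_add_eq t z (by omega), if_pos rfl,
        if_neg a2, if_neg a2]
      simp
    · have a1 : ¬ p = a := by rintro rfl; omega
      rw [hornerDiag_of_lt_add t z (by omega : m < (a : ℕ) + (k + 1)), if_neg a1]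
      by_cases hqa : q = a
      · subst hqa
        rw [hornerDiag_of_add_eq t w hq, if_pos rfl, if_pos rfl]
        simp
      · have : (a : ℕ) ≠ q := fun h => hqa (Fin.ext h.symm)
        rw [hornerDiag_of_lt_add t w (by omega), if_neg hqa, if_neg hqa]
        simp
  · have h1 : ∀ r : Fin m, ¬ (r = a ∧ r = b) := fun r h => hab (h.1.symm.trans h.2)
    simp [single, hab, h1]

/-- One Horner step. Cancelling the factor k on the right leaves, in block rows and columns m − k −
1 and m − k, the block [0, tz; t, tA_k] minus the corresponding block of `N`. As `N` is the identity
at m − k − 1, there is a pivot −1 there, and eliminating with it adds t · tz to tA_k, giving t(A_k +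
tz). -/
theorem twoSidedEquiv_hornerDiag_right (A : ℕ → R) (t : K) (z : R) {k : ℕ} (hk0 : k ≠ 0)
    (hk : k < m) {S : Set (Fin m)} {N : Matrix (Fin m) (Fin m) R} (hN : IdOutside S N)
    (hS : ∀ p ∈ S, m ≤ (p : ℕ) + k) :
    TwoSidedEquiv (diagonal (hornerDiag m (k + 1) t z) - N * blockFiedler m A k)
      (diagonal (hornerDiag m k t (A k + t • z)) - N) := by
  obtain ⟨p, hp⟩ : ∃ p : Fin m, (p : ℕ) + k + 1 = m := ⟨⟨m - k - 1, by omega⟩, by simp; omega⟩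
  obtain ⟨q, hq⟩ : ∃ q : Fin m, (q : ℕ) + k = m := ⟨⟨m - k, by omega⟩, by simp; omega⟩
  have hpq : p ≠ q := by rintro rfl; omega
  have hF : blockFiedler m A k * elemMid m k 0 (A k) = 1 := by
    rw [blockFiedler, if_neg hk0, elemMid_mul_elemMid hk0 hk]
  have hF' : elemMid m k 0 (A k) * blockFiedler m A k = 1 := by
    rw [blockFiedler, if_neg hk0, elemMid_mul_elemMid' hk0 hk]
  have hu : IsUnit (elemMid m k 0 (A k)) := ⟨⟨_, _, hF', hF⟩, rfl⟩
  have key : diagonal (hornerDiag m (k + 1) t z) * elemMid m k 0 (A k)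
      = diagonal (hornerDiag m k t (A k + t • z)) - single q q ((t • 1) * (t • z))
        + single q p (t • 1) + single p q (t • z) := by
    rw [elemMid_eq hp hq, diagonal_hornerDiag hp hq t z (A k + t • z)]
    simp only [mul_add, mul_sub, diagonal_mul_single, mul_one, one_mul,
      hornerDiag_of_add_eq t z (by omega : (p : ℕ) + (k + 1) = m),
      hornerDiag_of_lt_add t z (by omega : m < (q : ℕ) + (k + 1)), smul_add, single_add,
      smul_mul_assoc, mul_smul_comm, single_zero, mul_zero]
    abel
  have h2 := twoSidedEquiv_sub_of_pivot hpq hN (p := p) (d := hornerDiag m k t (A k + t • z))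
    (fun h => by have := hS _ h; omega) (if_pos (by omega)) (t • 1) (t • z)
  refine TwoSidedEquiv.trans (TwoSidedEquiv.mul_units 1 _ isUnit_one hu) ?_
  rw [one_mul, sub_mul, key, mul_assoc, hF, mul_one]
  exact h2

theorem twoSidedEquiv_hornerDiag_left (A : ℕ → R) (t : K) (z : R) {k : ℕ} (hk0 : k ≠ 0)
    (hk : k < m) {S : Set (Fin m)} {N : Matrix (Fin m) (Fin m) R} (hN : IdOutside S N)
    (hS : ∀ p ∈ S, m ≤ (p : ℕ) + k) :
    TwoSidedEquiv (diagonal (hornerDiag m (k + 1) t z) - blockFiedler m A k * N)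
      (diagonal (hornerDiag m k t (A k + t • z)) - N) := by
  obtain ⟨p, hp⟩ : ∃ p : Fin m, (p : ℕ) + k + 1 = m := ⟨⟨m - k - 1, by omega⟩, by simp; omega⟩
  obtain ⟨q, hq⟩ : ∃ q : Fin m, (q : ℕ) + k = m := ⟨⟨m - k, by omega⟩, by simp; omega⟩
  have hpq : p ≠ q := by rintro rfl; omega
  have hF : blockFiedler m A k * elemMid m k 0 (A k) = 1 := by
    rw [blockFiedler, if_neg hk0, elemMid_mul_elemMid hk0 hk]
  have hF' : elemMid m k 0 (A k) * blockFiedler m A k = 1 := by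
    rw [blockFiedler, if_neg hk0, elemMid_mul_elemMid' hk0 hk]
  have hu : IsUnit (elemMid m k 0 (A k)) := ⟨⟨_, _, hF', hF⟩, rfl⟩
  -- Multiplying on the left instead transposes the positions of t and tz; the Schur complement is
  -- the same because t is a central scalar.
  have key : elemMid m k 0 (A k) * diagonal (hornerDiag m (k + 1) t z)
      = diagonal (hornerDiag m k t (A k + t • z)) - single q q ((t • z) * (t • 1))
        + single q p (t • z) + single p q (t • 1) := by
    rw [elemMid_eq hp hq, diagonal_hornerDiag hp hq t z (A k + t • z)]
    simp only [add_mul, sub_mul, single_mul_diagonal, mul_one, one_mul,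
      hornerDiag_of_add_eq t z (by omega : (p : ℕ) + (k + 1) = m),
      hornerDiag_of_lt_add t z (by omega : m < (q : ℕ) + (k + 1)), smul_add, single_add,
      mul_smul_comm, single_zero, zero_mul]
    abel
  have h2 := twoSidedEquiv_sub_of_pivot hpq hN (p := p) (d := hornerDiag m k t (A k + t • z))
    (fun h => by have := hS _ h; omega) (if_pos (by omega)) (t • z) (t • 1)
  refine TwoSidedEquiv.trans (TwoSidedEquiv.mul_units _ 1 hu isUnit_one) ?_
  rw [mul_one, mul_sub, key, ← mul_assoc, hF', one_mul]
  exact h2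

/-- Induction on the number of remaining factors. The Horner value `z` stays arbitrary, since every
step replaces it by A_k + tz. The entries −1 are the pivots already used. -/
theorem twoSidedEquiv_hornerDiag (A : ℕ → R) (t : K) {k : ℕ} (hk : k + 1 ≤ m) (z : R)
    {l : List ℕ} (hl : l.Perm (List.range (k + 1))) :
    TwoSidedEquiv (diagonal (hornerDiag m (k + 1) t z) - (l.map (blockFiedler m A)).prod)
      (diagonal fun p => if (p : ℕ) + 1 = m then
        t ^ (k + 1) • z + ∑ i ∈ Finset.range (k + 1), t ^ i • A i else -1) := by
  induction k generalizing z l with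
  | zero =>
    obtain rfl : l = [0] := List.perm_singleton.1 (by simpa using hl)
    refine .of_eq ?_
    simp only [List.map_cons, List.map_nil, List.prod_cons, List.prod_nil, mul_one, blockFiedler,
      if_pos, elemLast, Matrix.diagonal_sub]
    congr 1
    ext p
    simp only [hornerDiag]
    have := p.2
    by_cases hp : (p : ℕ) + 1 = m
    · simp [hp]
    · rw [if_pos (by omega), if_neg hp, if_neg hp]; simp
  | succ k ih =>
    obtain ⟨l', hl', h⟩ := prod_blockFiedler_eq (m := m) A hl
    have hN : IdOutside {p : Fin m | m ≤ p + (k + 1)} (l'.map (blockFiedler m A)).prod := by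
      refine IdOutside.list_prod l' fun i hi => (idOutside_blockFiedler A i).mono ?_
      have : i < k + 1 := by simpa using hl'.mem_iff.1 hi
      intro p hp
      simp only [Set.mem_ofPred_eq] at hp ⊢
      omega
    have hstep := ih (by omega) (A (k + 1) + t • z) hl'
    have hval : t ^ (k + 1) • (A (k + 1) + t • z) + ∑ i ∈ Finset.range (k + 1), t ^ i • A i
        = t ^ (k + 1 + 1) • z + ∑ i ∈ Finset.range (k + 1 + 1), t ^ i • A i := by
      rw [Finset.sum_range_succ _ (k + 1), smul_add, smul_smul, ← pow_succ]
      abel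
    rw [hval] at hstep
    rcases h with h | h
    · rw [h]
      exact (twoSidedEquiv_hornerDiag_right A t z (by omega) (by omega) hN fun p hp => hp).trans
        hstep
    · rw [h]
      exact (twoSidedEquiv_hornerDiag_left A t z (by omega) (by omega) hN fun p hp => hp).trans
        hstep

/-- A Fiedler pencil is equivalent to `diag (-I, P)`. -/
theorem twoSidedEquiv_fiedler_pencil (hm : m ≠ 0) (A : ℕ → R) (t : K) {l : List ℕ}
    (hl : l.Perm (List.range m)) :
    TwoSidedEquiv (t • elemFirst m (A m) - (l.map (blockFiedler m A)).prod)
      (diagonal fun p => if (p : ℕ) + 1 = m then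
        ∑ i ∈ Finset.range (m + 1), t ^ i • A i else -1) := by
  obtain ⟨k, rfl⟩ := Nat.exists_eq_succ_of_ne_zero hm
  have := twoSidedEquiv_hornerDiag (m := k + 1) A t le_rfl (A (k + 1)) hl
  have e : diagonal (hornerDiag (k + 1) (k + 1) t (A (k + 1)))
      = t • elemFirst (k + 1) (A (k + 1)) := by
    rw [elemFirst, ← Matrix.diagonal_smul]
    congr 1
    ext p
    rw [hornerDiag, if_neg (by omega), Pi.smul_apply]
    by_cases hp : (p : ℕ) = 0
    · rw [if_pos (by omega), if_pos hp]
    · rw [if_neg (by omega), if_neg hp]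
  rw [e] at this
  rw [Nat.succ_eq_add_one, Finset.sum_range_succ _ (k + 1), add_comm (∑ i ∈ _, _)]
  exact this

theorem twoSidedEquiv_elemLast (hm : m ≠ 0) (A : ℕ → R) (t : K) {l : List ℕ}
    (hl : l.Perm (List.range m)) :
    TwoSidedEquiv (t • elemFirst m (A m) - (l.map (blockFiedler m A)).prod)
      (elemLast m (∑ i ∈ Finset.range (m + 1), t ^ i • A i)) := by
  refine (twoSidedEquiv_fiedler_pencil hm A t hl).trans ?_
  let D : Matrix (Fin m) (Fin m) R := diagonal fun p => if (p : ℕ) + 1 = m then 1 else -1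
  have hD : D * D = 1 := by
    rw [diagonal_mul_diagonal, ← diagonal_one]
    congr 1; ext p; split_ifs <;> simp
  have : elemLast m (∑ i ∈ Finset.range (m + 1), t ^ i • A i) = D *
      (diagonal fun p : Fin m => if (p : ℕ) + 1 = m then
        ∑ i ∈ Finset.range (m + 1), t ^ i • A i else -1) * 1 := by
    rw [mul_one, diagonal_mul_diagonal, elemLast]
    congr 1; ext p; split_ifs <;> simp
  rw [this]
  exact TwoSidedEquiv.mul_units _ _ ⟨⟨D, D, hD, hD⟩, rfl⟩ isUnit_one

/-! ### Block reversal and the reversed pencil. -/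

theorem twoSidedEquiv_reindex_rev (X : Matrix (Fin m) (Fin m) R) :
    TwoSidedEquiv X (reindexRingEquiv R Fin.revPerm X) := by
  let J : Matrix (Fin m) (Fin m) R := (1 : Matrix (Fin m) (Fin m) R).submatrix Fin.revPerm id
  have h1 : ∀ Y : Matrix (Fin m) (Fin m) R, J * Y = Y.submatrix Fin.revPerm id := fun Y => by
    ext a b; simp [J, Matrix.mul_apply, Matrix.one_apply]
  have h2 : ∀ Y : Matrix (Fin m) (Fin m) R, Y * J = Y.submatrix id Fin.revPerm := fun Y => by
    ext a b; simp [J, Matrix.mul_apply, Matrix.one_apply, Fin.rev_eq_iff]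
  have hJ : J * J = 1 := by rw [h1]; ext a b; simp [J, Matrix.one_apply]
  have hJu : IsUnit J := ⟨⟨J, J, hJ, hJ⟩, rfl⟩
  have : reindexRingEquiv R Fin.revPerm X = J * X * J := by
    rw [h1, h2]; ext a b; simp
  rw [this]
  exact TwoSidedEquiv.mul_units _ _ hJu hJu

theorem reindex_rev_elemFirst (Z : R) :
    reindexRingEquiv R Fin.revPerm (elemFirst m Z) = elemLast m Z := by
  ext a b
  simp only [elemFirst, elemLast, coe_reindexRingEquiv, reindex_apply, submatrix_apply,
    diagonal_apply, Fin.revPerm_symm, Fin.revPerm_apply, Fin.rev_inj, Fin.val_rev]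
  have := a.2
  split_ifs <;> first | rfl | omega

theorem reindex_rev_elemLast (Z : R) :
    reindexRingEquiv R Fin.revPerm (elemLast m Z) = elemFirst m Z := by
  rw [← reindex_rev_elemFirst]
  ext a b
  simp

/-- The flip carries block rows m − i − 1 and m − i to i and i − 1, which belong to index m − i, and
exchanges the two diagonal blocks. The inverse of a Fiedler factor thus becomes a Fiedler factor of
complementary index. -/
theorem reindex_rev_elemMid {i : ℕ} (hi : i < m) (B D : R) :
    reindexRingEquiv R Fin.revPerm (elemMid m i B D) = elemMid m (m - i) D B := by
  ext a b
  simp only [elemMid, coe_reindexRingEquiv, reindex_apply, submatrix_apply, of_apply,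
    Fin.revPerm_symm, Fin.revPerm_apply, Fin.rev_inj, Fin.val_rev]
  have := a.2
  have := b.2
  split_ifs <;> first | rfl | omega

/-- Cancelling every factor except the one of index 0 moves t onto that single factor, while the
inverses gather around `elemFirst m (A m)`. After the flip, the index-0 factor plays the role of the
leading block and the gathered product is a Fiedler product. -/
theorem twoSidedEquiv_elemLast_reverse (hm : m ≠ 0) (A : ℕ → R) (t : K) {l : List ℕ}
    (hl : l.Perm (List.range m)) :
    TwoSidedEquiv (elemFirst m (A m) - t • (l.map (blockFiedler m A)).prod)
      (elemLast m (∑ i ∈ Finset.range (m + 1), t ^ i • A (m - i))) := by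
  obtain ⟨s, r, rfl⟩ := List.append_of_mem (hl.mem_iff.2 (by simp; omega : 0 ∈ List.range m))
  have hlt : ∀ i, i ∈ s ∨ i ∈ r → i ≠ 0 ∧ i < m := fun i hi => by
    refine ⟨?_, by simpa using hl.mem_iff.1 (by simp; tauto : i ∈ s ++ 0 :: r)⟩
    rintro rfl
    have := hl.nodup_iff.2 List.nodup_range
    rw [List.nodup_middle, List.nodup_cons] at this
    exact this.1 (by simpa using hi)
  let f := blockFiedler m A
  let g : ℕ → Matrix (Fin m) (Fin m) R := fun i => elemMid m i 0 (A i)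
  have hfg : ∀ i, i ∈ s ∨ i ∈ r → f i * g i = 1 ∧ g i * f i = 1 := fun i hi => by
    obtain ⟨h0, h1⟩ := hlt i hi
    simp only [f, g, blockFiedler, if_neg h0]
    exact ⟨elemMid_mul_elemMid h0 h1 _, elemMid_mul_elemMid' h0 h1 _⟩
  have hus := isUnit_prod_map (f := g) (g := f) s.reverse
    fun i hi => (hfg i (.inl (by simpa using hi))).symm
  have hur := isUnit_prod_map (f := g) (g := f) r.reverse
    fun i hi => (hfg i (.inr (by simpa using hi))).symm
  have hs := prod_map_reverse_mul_prod_map (f := g) (g := f) s fun i hi => (hfg i (.inl hi)).2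
  have hr := prod_map_mul_prod_map_reverse (f := f) (g := g) r fun i hi => (hfg i (.inr hi)).1
  refine (TwoSidedEquiv.mul_units _ _ hus hur).trans ?_
  refine (twoSidedEquiv_reindex_rev _).trans ?_
  -- Coefficients of −rev P: the flipped inverses carry the block A_i, whereas `blockFiedler`
  -- carries the negative of its coefficient.
  let A' : ℕ → R := fun i => -A (m - i)
  -- The entry m stands for `elemFirst m (A m)`, which occupies the place of the removed index 0 and
  -- becomes index 0 after the flip.
  let l' : List ℕ := (s.reverse ++ m :: r.reverse).map (m - ·)
  have hl' : l'.Perm (List.range m) := by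
    have h1 : (s.reverse ++ m :: r.reverse).Perm ((List.range m).map (m - ·)) := by
      rw [List.perm_ext_iff_of_nodup]
      · intro i
        have := hl.mem_iff (a := i)
        have := hlt i
        simp only [List.mem_append, List.mem_cons, List.mem_reverse, List.mem_map, List.mem_range]
          at *
        constructor
        · rintro (h | rfl | h)
          · exact ⟨m - i, by have := hlt i (.inl h); omega, by have := hlt i (.inl h); omega⟩
          · exact ⟨0, by omega, by omega⟩
          · exact ⟨m - i, by have := hlt i (.inr h); omega, by have := hlt i (.inr h); omega⟩
        · rintro ⟨j, hj, rfl⟩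
          rcases Nat.eq_zero_or_pos j with rfl | hj0
          · simp
          · have := hl.mem_iff.2 (by simp; omega : m - j ∈ List.range m)
            simp only [List.mem_append, List.mem_cons] at this
            rcases this with h | h | h
            · exact .inl h
            · omega
            · exact .inr (.inr h)
      · have hnd := hl.nodup_iff.2 List.nodup_range
        rw [List.nodup_middle, List.nodup_cons] at hnd ⊢
        refine ⟨fun h => ?_, ?_⟩
        · have := hlt m (by simpa using h); omega
        · have hp : (s.reverse ++ r.reverse).Perm (s ++ r) :=
            (List.reverse_perm s).append (List.reverse_perm r)
          exact hp.nodup_iff.2 hnd.2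
      · refine List.Nodup.map_on ?_ List.nodup_range
        intro x hx y hy h
        simp at hx hy
        omega
    refine (h1.map _).trans ?_
    rw [List.map_map]
    have : (List.range m).map ((m - ·) ∘ (m - ·)) = List.range m := by
      conv_rhs => rw [← List.map_id (List.range m)]
      refine List.map_congr_left fun i hi => ?_
      simp at hi
      simp; omega
    rw [this]
  -- The normal form diag(−I, −rev P) is negated as a whole, so both signs disappear.
  have hmain := (twoSidedEquiv_fiedler_pencil hm A' t hl').neg
  let ρ := reindexRingEquiv R (Fin.revPerm (n := m))
  have hρsmul : ∀ X, ρ (t • X) = t • ρ X := fun X => rfl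
  have hρg : ∀ i, i ∈ s ∨ i ∈ r → ρ (g i) = blockFiedler m A' (m - i) := fun i hi => by
    obtain ⟨h0, h1⟩ := hlt i hi
    simp only [ρ, g, blockFiedler, A']
    rw [reindex_rev_elemMid h1, if_neg (by omega), Nat.sub_sub_self h1.le, neg_neg]
  have hρ1 : ∀ u : List ℕ, (∀ i ∈ u, i ∈ s ∨ i ∈ r) →
      ρ (u.map g).prod = ((u.map (m - ·)).map (blockFiedler m A')).prod := fun u hu => by
    rw [map_list_prod, List.map_map, List.map_map]
    exact congrArg List.prod (List.map_congr_left fun i hi => hρg i (hu i hi))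
  have hρ0 : ρ (f 0) = elemFirst m (A' m) := by
    simp only [ρ, f, blockFiedler, A', if_pos, reindex_rev_elemLast, Nat.sub_self]
  have hρm : ρ (elemFirst m (A m)) = blockFiedler m A' (m - m) := by
    simp only [ρ, blockFiedler, A', Nat.sub_self, if_pos, reindex_rev_elemFirst, Nat.sub_zero,
      neg_neg]
  have hX : (s.reverse.map g).prod * (elemFirst m (A m) - t • ((s ++ 0 :: r).map f).prod)
      * (r.reverse.map g).prod
      = (s.reverse.map g).prod * elemFirst m (A m) * (r.reverse.map g).prod - t • f 0 := by
    simp only [List.map_append, List.map_cons, List.prod_append, List.prod_cons]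
    rw [mul_sub, sub_mul, mul_smul_comm, smul_mul_assoc]
    congr 2
    calc _ = ((s.reverse.map g).prod * (s.map f).prod) * f 0
          * ((r.map f).prod * (r.reverse.map g).prod) := by simp only [mul_assoc]
      _ = f 0 := by rw [hs, hr, one_mul, mul_one]
  have hE : ρ ((s.reverse.map g).prod * (elemFirst m (A m) - t • ((s ++ 0 :: r).map f).prod)
      * (r.reverse.map g).prod)
      = -(t • elemFirst m (A' m) - (l'.map (blockFiedler m A')).prod) := by
    rw [hX, map_sub, hρsmul, hρ0, map_mul, map_mul, hρm,
      hρ1 _ (fun i hi => .inl (by simpa using hi)), hρ1 _ (fun i hi => .inr (by simpa using hi)),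
      neg_sub]
    simp only [l', List.map_append, List.map_cons, List.prod_append, List.prod_cons, mul_assoc]
  have hD : (-(diagonal fun p : Fin m => if (p : ℕ) + 1 = m then
        ∑ i ∈ Finset.range (m + 1), t ^ i • A' i else -1))
      = elemLast m (∑ i ∈ Finset.range (m + 1), t ^ i • A (m - i)) := by
    rw [elemLast, diagonal_neg]
    congr 1
    ext p
    simp only [A', smul_neg, Finset.sum_neg_distrib]
    split_ifs <;> simp
  rw [← hD]
  exact (TwoSidedEquiv.of_eq hE).trans hmain

end BlockFiedler

/-! ### Flattened block matrices over ℂ[X] and strong linearization. -/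

section Strong

open Matrix

variable {m n : ℕ}

theorem flat_mul {R : Type*} [CommRing R]
    (X Y : Matrix (Fin m) (Fin m) (Matrix (Fin n) (Fin n) R)) : flat (X * Y) = flat X * flat Y :=
  map_mul (compRingEquiv (Fin m) (Fin n) R) X Y

theorem flat_one {R : Type*} [CommRing R] :
    flat (1 : Matrix (Fin m) (Fin m) (Matrix (Fin n) (Fin n) R)) = 1 :=
  map_one (compRingEquiv (Fin m) (Fin n) R)

theorem isUnit_flat {R : Type*} [CommRing R]
    {X : Matrix (Fin m) (Fin m) (Matrix (Fin n) (Fin n) R)} (h : IsUnit X) : IsUnit (flat X) :=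
  h.map (compRingEquiv (Fin m) (Fin n) R)

theorem isUnit_diagonal_of {R : Type*} [Ring R] {d : Fin m → R} (h : ∀ p, IsUnit (d p)) :
    IsUnit (diagonal d) := by
  choose u hu using h
  refine ⟨⟨diagonal d, diagonal fun p => ((u p)⁻¹ : Rˣ), ?_, ?_⟩, rfl⟩ <;>
  · rw [diagonal_mul_diagonal, ← diagonal_one]
    congr 1
    ext p
    simp [← hu]

theorem isUnit_elemLast {R : Type*} [Ring R] {Z : R} (h : IsUnit Z) : IsUnit (elemLast m Z) :=
  isUnit_diagonal_of fun p => by split_ifs <;> simp [h]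

theorem isUnit_elemFirst {R : Type*} [Ring R] {Z : R} (h : IsUnit Z) : IsUnit (elemFirst m Z) :=
  isUnit_diagonal_of fun p => by split_ifs <;> simp [h]

/-- The block [B, I; I, 0] has inverse [0, I; I, −B], with no condition on B. This is why
nonsingularity of an assignment is needed only at ±0 and ±m. -/
theorem isUnit_elemMid_left {R : Type*} [Ring R] {i : ℕ} (hi0 : i ≠ 0) (hi : i < m) (B : R) :
    IsUnit (elemMid m i B 0) := by
  have h1 := elemMid_mul_elemMid hi0 hi (-B)
  have h2 := elemMid_mul_elemMid' hi0 hi (-B)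
  rw [neg_neg] at h1 h2
  exact ⟨⟨_, _, h1, h2⟩, rfl⟩

theorem isUnit_elemMid_right {R : Type*} [Ring R] {i : ℕ} (hi0 : i ≠ 0) (hi : i < m) (D : R) :
    IsUnit (elemMid m i 0 D) :=
  ⟨⟨_, _, elemMid_mul_elemMid' hi0 hi D, elemMid_mul_elemMid hi0 hi D⟩, rfl⟩

theorem isUnit_elemMat {t : SIndex} (ht : t.abs ≤ m) {Z : Matrix (Fin n) (Fin n) ℂ}
    (hZ : t.abs = 0 ∨ t.abs = m → IsUnit Z) : IsUnit (elemMat m n t Z) := by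
  have hinv : ∀ X : Matrix (Fin m × Fin n) (Fin m × Fin n) ℂ, IsUnit X → IsUnit X⁻¹ :=
    fun X hX => Matrix.isUnit_nonsing_inv_iff.2 hX
  cases t with
  | pos i =>
    simp only [SIndex.abs] at ht hZ
    simp only [elemMat]
    split_ifs with h0 h1
    · exact isUnit_flat (isUnit_elemLast (hZ (.inl h0)))
    · exact hinv _ (isUnit_flat (isUnit_elemFirst (hZ (.inr h1))))
    · exact isUnit_flat (isUnit_elemMid_left h0 (by omega) Z)
  | neg i =>
    simp only [SIndex.abs] at ht hZ
    simp only [elemMat]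
    split_ifs with h0 h1
    · exact hinv _ (isUnit_flat (isUnit_elemLast (hZ (.inl h0))))
    · exact isUnit_flat (isUnit_elemFirst (hZ (.inr h1)))
    · exact isUnit_flat (isUnit_elemMid_right h0 (by omega) Z)

theorem isUnit_elemProd {t : List SIndex} (ht : ∀ s ∈ t, s.abs ≤ m) {Z : MatAssignment n t}
    (hZ : Z.Nonsingular m) : IsUnit (elemProd m t Z) := by
  have h : ∀ x ∈ List.ofFn fun k : Fin t.length => elemMat m n (t.get k) (Z k), IsUnit x := by
    intro x hx
    obtain ⟨k, rfl⟩ := (List.mem_ofFn' _ _).1 hx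
    exact isUnit_elemMat (ht _ (List.get_mem t k)) (hZ k)
  rw [elemProd]
  generalize (List.ofFn fun k : Fin t.length => elemMat m n (t.get k) (Z k)) = l at h
  induction l with
  | nil => simp
  | cons x l ih =>
    rw [List.prod_cons]
    exact (h x List.mem_cons_self).mul (ih fun y hy => h y (List.mem_cons_of_mem _ hy))

theorem constPoly_mul {ι : Type*} [Fintype ι] [DecidableEq ι] (X Y : Matrix ι ι ℂ) :
    constPoly (X * Y) = constPoly X * constPoly Y :=
  map_mul (Polynomial.C.mapMatrix : Matrix ι ι ℂ →+* Matrix ι ι ℂ[X]) X Y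

theorem constPoly_one {ι : Type*} [Fintype ι] [DecidableEq ι] :
    constPoly (1 : Matrix ι ι ℂ) = 1 :=
  map_one (Polynomial.C.mapMatrix : Matrix ι ι ℂ →+* Matrix ι ι ℂ[X])

theorem constPoly_neg {ι : Type*} [Fintype ι] [DecidableEq ι] (X : Matrix ι ι ℂ) :
    constPoly (-X) = -constPoly X :=
  map_neg (Polynomial.C.mapMatrix : Matrix ι ι ℂ →+* Matrix ι ι ℂ[X]) X

theorem isUnit_constPoly {ι : Type*} [Fintype ι] [DecidableEq ι] {X : Matrix ι ι ℂ}
    (h : IsUnit X) : IsUnit (constPoly X) :=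
  h.map (Polynomial.C.mapMatrix : Matrix ι ι ℂ →+* Matrix ι ι ℂ[X])

theorem constPoly_flat (X : Matrix (Fin m) (Fin m) (Matrix (Fin n) (Fin n) ℂ)) :
    constPoly (flat X) = flat (X.map constPoly) := rfl

theorem constPoly_zero {ι : Type*} [Fintype ι] [DecidableEq ι] :
    constPoly (0 : Matrix ι ι ℂ) = 0 :=
  map_zero (Polynomial.C.mapMatrix : Matrix ι ι ℂ →+* Matrix ι ι ℂ[X])

/-- Identifies the concrete Fiedler matrices with the abstract ones over the ring of n × n blocks
with entries in ℂ[X]. -/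
theorem constPoly_fiedlerMat_pos (A : ℕ → Matrix (Fin n) (Fin n) ℂ) {i : ℕ} (hi : i < m) :
    constPoly (fiedlerMat m A (.pos i)) = flat (blockFiedler m (fun i => constPoly (A i)) i) := by
  rw [fiedlerMat, if_neg hi.ne, elemMat]
  by_cases h0 : i = 0
  · rw [if_pos h0, constPoly_flat, blockFiedler, if_pos h0, h0]
    congr 1
    rw [lastBlock, elemLast, diagonal_map constPoly_zero]
    congr 1
    ext1 p
    split_ifs
    · exact constPoly_neg _
    · exact constPoly_one
  · rw [if_neg h0, if_neg hi.ne, constPoly_flat, blockFiedler, if_neg h0]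
    congr 1
    ext1 p q
    simp only [midBlocks, elemMid, map_apply, of_apply]
    split_ifs
    · exact constPoly_neg _
    · exact constPoly_zero
    · exact constPoly_one
    · exact constPoly_one
    · exact constPoly_one
    · exact constPoly_zero

theorem constPoly_fiedlerMat_neg (A : ℕ → Matrix (Fin n) (Fin n) ℂ) (hm : m ≠ 0) :
    constPoly (fiedlerMat m A (.neg m)) = flat (elemFirst m (constPoly (A m))) := by
  rw [fiedlerMat, if_neg hm, elemMat, if_neg hm, if_pos rfl, constPoly_flat]
  congr 1
  rw [firstBlock, elemFirst, diagonal_map constPoly_zero]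
  congr 1
  ext1 p
  split_ifs
  · rfl
  · exact constPoly_one

theorem constPoly_fiedlerProd (A : ℕ → Matrix (Fin n) (Fin n) ℂ) (l : List SIndex) :
    constPoly (fiedlerProd m A l) = (l.map fun s => constPoly (fiedlerMat m A s)).prod := by
  induction l with
  | nil => exact constPoly_one
  | cons s l ih =>
    rw [List.map_cons, List.prod_cons, ← ih, ← constPoly_mul]
    rfl

theorem fiedlerMat_mul_inv (hm : m ≠ 0) (A : ℕ → Matrix (Fin n) (Fin n) ℂ) {i : ℕ} (hi : i ≤ m)
    (h0 : i = 0 → IsUnit (A 0)) (h1 : i = m → IsUnit (A m)) :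
    constPoly (fiedlerMat m A (.pos i)) * constPoly (fiedlerMat m A (.neg i)) = 1 ∧
      constPoly (fiedlerMat m A (.neg i)) * constPoly (fiedlerMat m A (.pos i)) = 1 := by
  suffices h : fiedlerMat m A (.pos i) * fiedlerMat m A (.neg i) = 1 by
    rw [← constPoly_mul, ← constPoly_mul, h, mul_eq_one_comm.1 h, constPoly_one]
    exact ⟨rfl, rfl⟩
  have hinv : ∀ X : Matrix (Fin m × Fin n) (Fin m × Fin n) ℂ, IsUnit X → X * X⁻¹ = 1 ∧ X⁻¹ * X = 1 :=
    fun X hX => by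
      rw [Matrix.isUnit_iff_isUnit_det] at hX
      exact ⟨Matrix.mul_nonsing_inv _ hX, Matrix.nonsing_inv_mul _ hX⟩
  simp only [fiedlerMat]
  by_cases hi0 : i = 0
  · subst hi0
    rw [if_neg (by omega), if_pos rfl]
    exact (hinv _ (isUnit_elemMat (Nat.zero_le _) fun _ => (h0 rfl).neg)).1
  · rw [if_neg hi0]
    by_cases him : i = m
    · subst him
      rw [if_pos rfl]
      exact (hinv _ (isUnit_elemMat (t := .neg i) le_rfl fun _ => h1 rfl)).2
    · rw [if_neg him]
      simp only [elemMat, if_neg hi0, if_neg him]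
      rw [← flat_mul]
      exact (congrArg flat (elemMid_mul_elemMid hi0 (by omega) (A i))).trans flat_one

theorem isUnimodular_of_isUnit {ι : Type*} [Fintype ι] [DecidableEq ι] {U : Matrix ι ι ℂ[X]}
    (h : IsUnit U) : IsUnimodular U := by
  rw [Matrix.isUnit_iff_isUnit_det, Polynomial.isUnit_iff] at h
  obtain ⟨c, hc, h⟩ := h
  exact ⟨c, hc.ne_zero, h.symm⟩

theorem TwoSidedEquiv.isLinearization {L : Matrix (Fin m × Fin n) (Fin m × Fin n) ℂ[X]}
    {P : Matrix (Fin n) (Fin n) ℂ[X]} (h : TwoSidedEquiv L (flat (elemLast m P))) :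
    IsLinearization m L P := by
  obtain ⟨u, v, h⟩ := h
  exact ⟨u, v, isUnimodular_of_isUnit u.isUnit, isUnimodular_of_isUnit v.isUnit, h⟩

theorem revPoly_matPoly (A : ℕ → Matrix (Fin n) (Fin n) ℂ) :
    revPoly m (matPoly m A)
      = ∑ i ∈ Finset.range (m + 1), (Polynomial.X : ℂ[X]) ^ i • constPoly (A (m - i)) := by
  -- After i ↦ m − i the sums agree term by term, as reflection sends X ^ i to X ^ (m − i).
  rw [← Finset.sum_flip fun i => (Polynomial.X : ℂ[X]) ^ i • constPoly (A (m - i))]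
  ext1 a b
  let r : ℂ[X] →+ ℂ[X] :=
    { toFun := Polynomial.reflect m
      map_zero' := Polynomial.reflect_zero
      map_add' := fun f g => Polynomial.reflect_add f g m }
  change r (matPoly m A a b) = _
  rw [matPoly, Matrix.sum_apply, Matrix.sum_apply, map_sum]
  refine Finset.sum_congr rfl fun i hi => ?_
  have hi : i ≤ m := by simpa [Nat.lt_succ_iff] using hi
  change Polynomial.reflect m (Polynomial.X ^ i * Polynomial.C (A i a b))
    = Polynomial.X ^ (m - i) * Polynomial.C (A (m - (m - i)) a b)
  rw [mul_comm, Polynomial.reflect_C_mul_X_pow, Polynomial.revAt_le hi, mul_comm,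
    Nat.sub_sub_self hi]

theorem twoSidedEquiv_generalizedFiedler (hm : m ≠ 0) (A : ℕ → Matrix (Fin n) (Fin n) ℂ)
    {σ ω : List ℕ} (hperm : (σ ++ ω).Perm (List.range (m + 1)))
    (hA0 : 0 ∈ ω → IsUnit (A 0)) (hAm : m ∈ σ → IsUnit (A m)) :
    TwoSidedEquiv
      ((Polynomial.X : ℂ[X]) • constPoly (fiedlerProd m A (ω.map SIndex.neg))
        - constPoly (fiedlerProd m A (σ.map SIndex.pos))) (flat (elemLast m (matPoly m A))) ∧
    TwoSidedEquiv
      (constPoly (fiedlerProd m A (ω.map SIndex.neg))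
        - (Polynomial.X : ℂ[X]) • constPoly (fiedlerProd m A (σ.map SIndex.pos)))
      (flat (elemLast m (revPoly m (matPoly m A)))) := by
  -- The scalars stay free: (X, 1) gives the pencil and (1, X) its reversal.
  have key := fun a b : ℂ[X] => exists_twoSidedEquiv_fiedler a b
    (f := fun i => constPoly (fiedlerMat m A (.pos i)))
    (g := fun i => constPoly (fiedlerMat m A (.neg i))) hperm
    (fun i h0 h1 => fiedlerMat_mul_inv hm A h1.le (fun h => absurd h h0) fun h => absurd h h1.ne)
    (fun h => fiedlerMat_mul_inv hm A (Nat.zero_le m) (fun _ => hA0 h) fun h => absurd h.symm hm)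
    (fun h => fiedlerMat_mul_inv hm A le_rfl (fun h => absurd h hm) fun _ => hAm h)
  have hflat : ∀ (a b : ℂ[X]) (l : List ℕ), l.Perm (List.range m) →
      a • constPoly (fiedlerMat m A (.neg m))
        - b • (l.map fun i => constPoly (fiedlerMat m A (.pos i))).prod
      = compRingEquiv (Fin m) (Fin n) ℂ[X] (a • elemFirst m (constPoly (A m))
        - b • (l.map (blockFiedler m fun i => constPoly (A i))).prod) := fun a b l hl => by
    have h1 : l.map (fun i => constPoly (fiedlerMat m A (.pos i)))
        = (l.map (blockFiedler m fun i => constPoly (A i))).map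
          (compRingEquiv (Fin m) (Fin n) ℂ[X]) := by
      rw [List.map_map]
      exact List.map_congr_left fun i hi =>
        constPoly_fiedlerMat_pos A (by simpa using hl.mem_iff.1 hi)
    rw [h1, ← map_list_prod, constPoly_fiedlerMat_neg A hm, map_sub]
    rfl
  simp only [constPoly_fiedlerProd, List.map_map, Function.comp_def]
  constructor
  · obtain ⟨l, hl, h⟩ := key Polynomial.X 1
    rw [hflat _ _ _ hl] at h
    simp only [one_smul] at h
    exact h.trans ((twoSidedEquiv_elemLast hm (fun i => constPoly (A i)) Polynomial.X hl).map
      (compRingEquiv (Fin m) (Fin n) ℂ[X]).toRingHom)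
  · obtain ⟨l, hl, h⟩ := key 1 Polynomial.X
    rw [hflat _ _ _ hl] at h
    simp only [one_smul] at h
    rw [revPoly_matPoly]
    exact h.trans ((twoSidedEquiv_elemLast_reverse hm (fun i => constPoly (A i)) Polynomial.X hl).map
      (compRingEquiv (Fin m) (Fin n) ℂ[X]).toRingHom)

end Strong

theorem mainTheorem1 (m n : ℕ) (hm : 2 ≤ m) (A : ℕ → Matrix (Fin n) (Fin n) ℂ) (hA : A m ≠ 0)
    (σ ω : List ℕ) (σ₁ σ₂ τ₁ τ₂ : List SIndex) (hidx : IsEGFPTuple m σ ω σ₁ σ₂ τ₁ τ₂)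
    -- the inverses in `M_{-0}^P` and `M_m^P` exist whenever these matrices occur
    (hA0 : 0 ∈ ω → IsUnit (A 0)) (hAm : m ∈ σ → IsUnit (A m))
    (X₁ : MatAssignment n σ₁) (X₂ : MatAssignment n σ₂)
    (Y₁ : MatAssignment n τ₁) (Y₂ : MatAssignment n τ₂)
    (hX₁ : X₁.Nonsingular m) (hX₂ : X₂.Nonsingular m)
    (hY₁ : Y₁.Nonsingular m) (hY₂ : Y₂.Nonsingular m) :
    IsStrongLinearization m (egfp m A σ ω X₁ X₂ Y₁ Y₂) (matPoly m A) := by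
  have hle : ∀ i, i ∈ σ ∨ i ∈ ω → i ≤ m := fun i hi => by
    have := hidx.perm.mem_iff.1 (List.mem_append.2 hi)
    simpa [Nat.lt_succ_iff] using this
  have hσ : ∀ s, s ∈ σ₁ ∨ s ∈ σ₂ → s.abs ≤ m := fun s hs => by
    obtain ⟨i, hi, rfl⟩ := List.mem_map.1 (hidx.mem_sigma s hs).1
    exact hle i (.inl hi)
  have hτ : ∀ s, s ∈ τ₁ ∨ s ∈ τ₂ → s.abs ≤ m := fun s hs => by
    obtain ⟨i, hi, rfl⟩ := List.mem_map.1 (hidx.mem_tau s hs).1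
    exact hle i (.inr hi)
  have hu : IsUnit (elemProd m τ₁ Y₁ * elemProd m σ₁ X₁) :=
    (isUnit_elemProd (fun s hs => hτ s (.inl hs)) hY₁).mul
      (isUnit_elemProd (fun s hs => hσ s (.inl hs)) hX₁)
  have hv : IsUnit (elemProd m σ₂ X₂ * elemProd m τ₂ Y₂) :=
    (isUnit_elemProd (fun s hs => hσ s (.inr hs)) hX₂).mul
      (isUnit_elemProd (fun s hs => hτ s (.inr hs)) hY₂)
  obtain ⟨h1, h2⟩ := twoSidedEquiv_generalizedFiedler (by omega) A hidx.perm hA0 hAm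
  have e1 : egfp m A σ ω X₁ X₂ Y₁ Y₂ = constPoly (elemProd m τ₁ Y₁ * elemProd m σ₁ X₁) *
      ((Polynomial.X : ℂ[X]) • constPoly (fiedlerProd m A (ω.map SIndex.neg))
        - constPoly (fiedlerProd m A (σ.map SIndex.pos))) *
      constPoly (elemProd m σ₂ X₂ * elemProd m τ₂ Y₂) := by
    simp only [egfp, constPoly_mul, mul_assoc]
  set U := elemProd m τ₁ Y₁ * elemProd m σ₁ X₁
  set V := elemProd m σ₂ X₂ * elemProd m τ₂ Y₂
  set S := fiedlerProd m A (σ.map SIndex.pos)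
  set T := fiedlerProd m A (ω.map SIndex.neg)
  -- Constant and leading coefficients of U(λT − S)V; exchanging them gives U(T − λS)V, with the
  -- same outer factors.
  refine ⟨-(U * S * V), U * T * V, ?_, ?_, ?_⟩
  · rw [e1, pencil]
    simp only [constPoly_mul, constPoly_neg, mul_sub, sub_mul, Matrix.mul_smul, Matrix.smul_mul]
    abel
  · rw [e1]
    exact ((TwoSidedEquiv.of_mul_units _ _ (isUnit_constPoly hu) (isUnit_constPoly hv)).trans
      h1).isLinearization
  · have e2 : pencil (U * T * V) (-(U * S * V)) = constPoly U *
        (constPoly T - (Polynomial.X : ℂ[X]) • constPoly S) * constPoly V := by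
      rw [pencil]
      simp only [constPoly_mul, constPoly_neg, mul_sub, sub_mul, Matrix.mul_smul, Matrix.smul_mul,
        smul_neg]
      abel
    rw [e2]
    exact ((TwoSidedEquiv.of_mul_units _ _ (isUnit_constPoly hu) (isUnit_constPoly hv)).trans
      h2).isLinearization
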